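/- Let $K\ge 1$, $\mathrm{SNR}>0$, and let $(h_{jk})_{1\le j,k\le K}$ be real numbers with $h_{jk}\in\mathbb Z$ whenever $j\neq k$. Consider the real $K$-user Gaussian interference channel $$Y_j=h_{jj}X_j+\sum_{k\ne j}h_{jk}X_k+Z_j,\qquad j=1,\dots,K,$$ where the noises are independent over receivers and channel uses, $Z_j\sim\mathcal N(0,1/\mathrm{SNR})$. A code of block length $n$ and symmetric rate $R$ consists of encoders $f_k:\{1,\dots,\lceil 2^{nR}\rceil\}\to\mathbb R^n$ with $\frac1n\mathbb E\|f_k(w_k)\|^2\le 1$ for $w_k$ uniform, and (measurable) decoders $g_j:\mathbb R^n\to\{1,\dots,\lceil 2^{nR}\rceil\}$. Its error probability is the probability that $g_j(\mathbf y_j)\neq w_j$ for at least one $j$, where $\mathbf y_j$ is the block received by receiver $j$ when the codewords $f_k(w_k)$ are sent, with independent uniform messages $w_1,\dots,w_K$. The symmetric rate $R$ is achievable if there are such codes for all $n$ with error probability tending to $0$ as $n\to\infty$. All logarithms are to base $2$. For a prime $p$ and $\gamma\in\mathbb R$ put $$\delta(p,\gamma)=\min_{l\in\{1,\dots,p-1\}}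 l\cdot\left|\gamma-\frac{\lfloor l\gamma\rceil}{l}\right|,$$ where $\lfloor x\rceil$ is the integer nearest to $x$, and $$\mathcal P'(\gamma)=\left\{p\text{ prime}: e^{-\frac{3\,\mathrm{SNR}}{2p^2}\left(\gamma_{\bmod[-\frac14,\frac14)}\right)^2}<1-2p\,e^{-\frac{3\,\mathrm{SNR}}{8}}\right\},$$ where $\gamma_{\bmod[-\frac14,\frac14)}$ is the unique element of $[-\frac14,\frac14)\cap(\gamma+\frac12\mathbb Z)$. Then every symmetric rate $R$ satisfying $$R<\max_{p\in\bigcap_{j=1}^K\mathcal P'(h_{jj})}\ \min_{1\le j\le K}\ \min\left\{-\tfrac12\log\left(\tfrac1{p^2}+\sqrt{\tfrac{2\pi/3}{\mathrm{SNR}}}+\tfrac1p e^{-\frac{3\,\mathrm{SNR}}{2p^2}\delta^2(p,h_{jj})}+2e^{-\frac{3\,\mathrm{SNR}}{8}}\right),\ -\log\left(\tfrac1p+\sqrt{\tfrac{2\pi/3}{\delta^2(p,h_{jj})\,\mathrm{SNR}}}+2e^{-\frac{3\,\mathrm{SNR}}{8}}\right)\right\}$$ is achievable. Here the second term is $-\infty$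 if $\delta(p,h_{jj})=0$, and the maximum over the empty set is $-\infty$. -/

import Mathlib

open MeasureTheory ProbabilityTheory Filter Topology

noncomputable section

/-- Number of messages of a rate-`R` code of blocklength `n`: the integer version of `2 ^ (n R)`. -/
def numMessages (n : ℕ) (R : ℝ) : ℕ := ⌈(2 : ℝ) ^ ((n : ℝ) * R)⌉₊

/-- A blocklength-`n` code for the `K`-user interference channel, where user `k` has `M k` messages.
The power constraint is `(1/n) E ‖x_k‖² ≤ 1`, the expectation being over a uniform message. -/
structure InterferenceCode (K n : ℕ) (M : Fin K → ℕ) where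
  enc : ∀ k, Fin (M k) → Fin n → ℝ
  dec : ∀ j, (Fin n → ℝ) → Fin (M j)
  measurable_dec : ∀ j, Measurable (dec j)
  power : ∀ k, (1 / (n : ℝ)) * ((1 / (M k : ℝ)) * ∑ w, ∑ t, (enc k w t) ^ 2) ≤ 1

/-- Law of the noise: i.i.d. over receivers and channel uses, centred Gaussian with variance
`1 / SNR`. -/
def noiseLaw (K n : ℕ) (SNR : ℝ) : Measure (Fin K → Fin n → ℝ) :=
  Measure.pi fun _ => Measure.pi fun _ => gaussianReal 0 (1 / SNR).toNNReal

/-- The block received by receiver `j` when the codewords `x` are sent and the noise is `z`;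
`h j k` is the gain from transmitter `k` to receiver `j`. -/
def received {K n : ℕ} (h : Fin K → Fin K → ℝ) (x z : Fin K → Fin n → ℝ) (j : Fin K) :
    Fin n → ℝ :=
  fun t => (∑ k, h j k * x k t) + z j t

/-- Probability that at least one receiver errs, averaged over uniform messages. -/
def InterferenceCode.errorProb {K n : ℕ} {M : Fin K → ℕ} (C : InterferenceCode K n M)
    (h : Fin K → Fin K → ℝ) (SNR : ℝ) : ℝ :=
  (1 / (∏ k, (M k : ℝ))) * ∑ w : (∀ k, Fin (M k)),
    (noiseLaw K n SNR).real
      {z | ∃ j, C.dec j (received h (fun k => C.enc k (w k)) z j) ≠ w j}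

/-- Achievability of a rate tuple (in bits per channel use). -/
def RateTupleAchievable {K : ℕ} (h : Fin K → Fin K → ℝ) (SNR : ℝ) (R : Fin K → ℝ) : Prop :=
  ∃ C : ∀ n : ℕ, InterferenceCode K n (fun k => numMessages n (R k)),
    Tendsto (fun n => (C n).errorProb h SNR) atTop (𝓝 0)

/-- Achievability of a symmetric rate. -/
def SymmetricRateAchievable {K : ℕ} (h : Fin K → Fin K → ℝ) (SNR R : ℝ) : Prop :=
  RateTupleAchievable h SNR (fun _ => R)

/-- `δ(p, γ)`, the minimum over `l = 1, …, p - 1` of `l * |γ - ⌊l γ⌉ / l|`. -/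
def diophDelta (p : ℕ) (γ : ℝ) : ℝ :=
  sInf ((fun l : ℕ => (l : ℝ) * |γ - (round ((l : ℝ) * γ) : ℝ) / (l : ℝ)|) '' Set.Ico 1 p)

/-- `γ` reduced modulo the interval `[-1/4, 1/4)`, which has length `1/2`. -/
def modQuarter (γ : ℝ) : ℝ :=
  toIcoMod (show (0 : ℝ) < 1 / 2 by norm_num) (-(1 / 4)) γ

/-- The set `𝒫'(γ)` of admissible primes. -/
def admissiblePrimes (SNR γ : ℝ) : Set ℕ :=
  {p | p.Prime ∧
    Real.exp (-(3 * SNR / (2 * (p : ℝ) ^ 2)) * (modQuarter γ) ^ 2)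
      < 1 - 2 * (p : ℝ) * Real.exp (-(3 * SNR / 8))}

/-- First term of the rate bound. -/
def rateTermOne (SNR : ℝ) (p : ℕ) (γ : ℝ) : ℝ :=
  -(1 / 2) * Real.logb 2
    (1 / (p : ℝ) ^ 2 + √((2 * Real.pi / 3) / SNR)
      + (1 / (p : ℝ)) * Real.exp (-(3 * SNR / (2 * (p : ℝ) ^ 2)) * (diophDelta p γ) ^ 2)
      + 2 * Real.exp (-(3 * SNR / 8)))

open Classical in
/-- Second term of the rate bound. When `δ(p, γ) = 0` the argument of the logarithm is `+∞`, so the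
term is `-∞`. -/
def rateTermTwo (SNR : ℝ) (p : ℕ) (γ : ℝ) : EReal :=
  if diophDelta p γ = 0 then ⊥
  else ((-Real.logb 2
    (1 / (p : ℝ) + √((2 * Real.pi / 3) / ((diophDelta p γ) ^ 2 * SNR))
      + 2 * Real.exp (-(3 * SNR / 8))) : ℝ) : EReal)

/-- The minimum of the two terms. -/
def rateBound (SNR : ℝ) (p : ℕ) (γ : ℝ) : EReal :=
  min (rateTermOne SNR p γ : EReal) (rateTermTwo SNR p γ)

end

/-! All users draw their codewords from one random linear code over `ZMod p`, with a common random
dither, mapped to `p` points of spacing `√12 / p`. Because the cross gains are integers, the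
interference at receiver `j` equals, modulo `√12`, a single codeword-like signal indexed by one
vector `v`, the integer combination of the interfering message vectors
(`DitheredCode.sum_gain_mul_enc`). However many interferers there are, a receiver faces one desired
vector `u` and one nuisance vector `v`.

The receiver scores a message by summing over `v` the square roots of the Gaussian likelihoods,
periodized with period `√12`. Markov's inequality then gives a Bhattacharyya union bound over
competing pairs `(u', v')` (`exists_decoder`). On averaging over the code the channel uses factor,
and each pair falls into one of two cases (`DitheredCode.sum_prod_le`). If `v' - v` is not a
multiple of `u' - u`, the two symbol differences are jointly uniform on `ZMod p × ZMod p` and one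
channel use contributes `rateArgOne`. If `v' - v = l • (u' - u)`, the differences lie on a line and
one channel use contributes `rateArgTwo`. Both values come from one packing estimate,
`tsum_gaussWeight_le`, with separation `1` in the first case and `diophDelta` in the second.

With `M` messages there are at most `M * p ^ m` pairs of the first kind and `M * p` of the second.
Taking `p ^ m` within a factor `p` of `M` yields errors of order `(2 ^ (2 * R) * rateArgOne) ^ n`
and `(2 ^ R * rateArgTwo) ^ n`, which explains the factor `1 / 2` in the first rate term only. The
mean power is at most `1 - 1 / p ^ 2`, and this slack lets one code meet the power and error
requirements together (`exists_le_one_and_le`). -/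

open scoped ENNReal

noncomputable section

/-! ### Periodic Gaussian sums and a packing estimate -/

/-- A Gaussian function with maximum `1`, with values in `[0, ∞]`. -/
def gaussWeight (α x : ℝ) : ℝ≥0∞ := ENNReal.ofReal (Real.exp (-α * x ^ 2))

/-- The `P`-periodic sum of the Gaussian function `gaussWeight α`. -/
def periodicGauss (α P x : ℝ) : ℝ≥0∞ := ∑' a : ℤ, gaussWeight α (x + P * a)

lemma measurable_gaussWeight (α : ℝ) : Measurable (gaussWeight α) := by
  unfold gaussWeight; fun_prop

lemma measurable_periodicGauss (α P : ℝ) : Measurable (periodicGauss α P) := by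
  unfold periodicGauss
  refine Measurable.tsum fun a => ?_
  exact (measurable_gaussWeight α).comp (by fun_prop)

lemma gaussWeight_anti {α x y : ℝ} (hα : 0 < α) (h : |x| ≤ |y|) :
    gaussWeight α y ≤ gaussWeight α x := by
  unfold gaussWeight
  refine ENNReal.ofReal_le_ofReal (Real.exp_le_exp.2 ?_)
  have := sq_le_sq.2 h
  nlinarith

lemma periodicGauss_add_int_mul (α P x : ℝ) (q : ℤ) :
    periodicGauss α P (x + P * q) = periodicGauss α P x := by
  unfold periodicGauss
  rw [← (Equiv.addLeft q).tsum_eq (fun a : ℤ => gaussWeight α (x + P * a))]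
  refine tsum_congr fun a => ?_
  simp only [Equiv.coe_addLeft]
  push_cast
  ring_nf

lemma periodicGauss_mul (α P x c : ℝ) :
    periodicGauss α (c * P) (c * x) = periodicGauss (α * c ^ 2) P x := by
  unfold periodicGauss gaussWeight
  refine tsum_congr fun a => ?_
  congr 2
  ring

lemma gaussWeight_le_periodicGauss (α P x : ℝ) : gaussWeight α x ≤ periodicGauss α P x := by
  have := ENNReal.le_tsum (f := fun a : ℤ => gaussWeight α (x + P * a)) 0
  simpa [periodicGauss] using this

lemma lintegral_gaussWeight {α : ℝ} (hα : 0 < α) :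
    ∫⁻ x, gaussWeight α x = ENNReal.ofReal √(Real.pi / α) := by
  unfold gaussWeight
  rw [← integral_gaussian α, ofReal_integral_eq_lintegral_ofReal (integrable_exp_neg_mul_sq hα)]
  exact ae_of_all _ fun x => (Real.exp_pos _).le

/-- A Gaussian summed over a `δ`-separated family of points is at most its largest value plus its
integral divided by `δ`. -/
lemma tsum_gaussWeight_le {ι : Type*} [Countable ι] {α δ : ℝ} (hα : 0 < α) (hδ : 0 < δ)
    (x : ι → ℝ) (hsep : ∀ i j, i ≠ j → δ ≤ |x i - x j|) (i₀ : ι) (hmin : ∀ i, |x i₀| ≤ |x i|) :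
    ∑' i, gaussWeight α (x i) ≤ gaussWeight α (x i₀) + ENNReal.ofReal (√(Real.pi / α) / δ) := by
  classical
  -- Each point other than `x i₀` receives an interval of length `δ` on its side facing `x i₀`.
  -- Separation makes these intervals disjoint, and minimality of `|x i₀|` makes the Gaussian on
  -- each at least its value at the point.
  let I : ι → Set ℝ := fun i =>
    if x i₀ < x i then Set.Ioc (x i - δ) (x i)
    else if x i < x i₀ then Set.Ico (x i) (x i + δ) else ∅
  have hI : ∀ i, MeasurableSet (I i) := by
    intro i
    simp only [I]
    split_ifs
    exacts [measurableSet_Ioc, measurableSet_Ico, MeasurableSet.empty]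
  have hdisj : Pairwise (Function.onFun Disjoint I) := by
    intro i j hij
    rw [Function.onFun, Set.disjoint_left]
    intro u hu hu'
    have hcase : ∀ i, u ∈ I i → (x i₀ < u ∧ x i - δ < u ∧ u ≤ x i) ∨
        (u < x i₀ ∧ x i ≤ u ∧ u < x i + δ) := by
      intro i hu
      simp only [I] at hu
      split_ifs at hu with h h'
      · left
        have h1 := hsep i i₀ fun hi => by simp [hi] at h
        rw [abs_of_pos (by linarith)] at h1
        exact ⟨by linarith [hu.1], hu⟩
      · right
        have h1 := hsep i i₀ fun hi => by simp [hi] at h'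
        rw [abs_of_neg (by linarith)] at h1
        exact ⟨by linarith [hu.2], hu⟩
      · simp at hu
    have h1 := hsep i j hij
    rcases hcase i hu with hu | hu <;> rcases hcase j hu' with hu' | hu' <;>
      rcases le_abs.1 h1 with h1 | h1 <;> linarith
  have hterm : ∀ i, i ≠ i₀ →
      ENNReal.ofReal δ * gaussWeight α (x i) ≤ ∫⁻ u in I i, gaussWeight α u := by
    intro i hi
    have h1 := hsep i i₀ hi
    have h2 := hmin i
    have hvol : volume (I i) = ENNReal.ofReal δ := by
      simp only [I]
      split_ifs with h h'
      · simp
      · simp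
      · have : x i = x i₀ := by linarith
        rw [this] at h1; simp at h1; linarith
    have hle : ∀ u ∈ I i, |u| ≤ |x i| := by
      intro u hu
      simp only [I] at hu
      split_ifs at hu with h h'
      · simp only [Set.mem_Ioc] at hu
        have h3 : δ ≤ x i - x i₀ := by rwa [abs_of_pos (by linarith)] at h1
        have h4 : 0 ≤ x i := by
          by_contra hneg
          rw [abs_of_neg (by linarith), abs_of_neg (by linarith)] at h2
          linarith
        rw [abs_of_nonneg h4] at h2 ⊢
        rw [abs_le] at h2 ⊢
        constructor <;> linarith
      · simp only [Set.mem_Ico] at hu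
        have h3 : δ ≤ x i₀ - x i := by
          rw [abs_of_neg (by linarith)] at h1; linarith
        have h4 : x i ≤ 0 := by
          by_contra hneg
          rw [abs_of_pos (by linarith), abs_of_pos (by linarith)] at h2
          linarith
        rw [abs_of_nonpos h4] at h2 ⊢
        rw [abs_le] at h2 ⊢
        constructor <;> linarith
      · simp at hu
    calc ENNReal.ofReal δ * gaussWeight α (x i)
        = ∫⁻ _ in I i, gaussWeight α (x i) := by
          rw [setLIntegral_const, hvol, mul_comm]
      _ ≤ _ := setLIntegral_mono (measurable_gaussWeight α)
          fun u hu => gaussWeight_anti hα (hle u hu)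
  have hδ0 : ENNReal.ofReal δ ≠ 0 := by simpa using hδ
  have hsum : ∑' i, (if i = i₀ then 0 else gaussWeight α (x i))
      ≤ ENNReal.ofReal (√(Real.pi / α) / δ) := by
    rw [ENNReal.ofReal_div_of_pos hδ, ENNReal.le_div_iff_mul_le (Or.inl hδ0)
      (Or.inl ENNReal.ofReal_ne_top), mul_comm, ← ENNReal.tsum_mul_left]
    calc ∑' i, ENNReal.ofReal δ * (if i = i₀ then 0 else gaussWeight α (x i))
        ≤ ∑' i, ∫⁻ u in I i, gaussWeight α u := by
          refine ENNReal.tsum_le_tsum fun i => ?_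
          split_ifs with h
          · simp
          · exact hterm i h
      _ = ∫⁻ u in ⋃ i, I i, gaussWeight α u := (lintegral_iUnion hI hdisj _).symm
      _ ≤ ∫⁻ u, gaussWeight α u := setLIntegral_le_lintegral _ _
      _ = _ := lintegral_gaussWeight hα
  calc ∑' i, gaussWeight α (x i)
      = ∑' i, ((if i = i₀ then gaussWeight α (x i₀) else 0)
          + (if i = i₀ then 0 else gaussWeight α (x i))) := by
        refine tsum_congr fun i => ?_
        split_ifs with hi
        · rw [hi, add_zero]
        · rw [zero_add]
    _ = gaussWeight α (x i₀) + ∑' i, (if i = i₀ then 0 else gaussWeight α (x i)) := by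
        rw [ENNReal.tsum_add, tsum_ite_eq]
    _ ≤ _ := add_le_add le_rfl hsum

/-! ### Bhattacharyya integrals and the decoder -/

lemma lintegral_pi_prod_eq_prod {n : ℕ} (μ : Measure ℝ) [IsProbabilityMeasure μ]
    (f : Fin n → ℝ → ℝ≥0∞) (hf : ∀ t, Measurable (f t)) :
    ∫⁻ z, ∏ t, f t (z t) ∂(Measure.pi fun _ => μ) = ∏ t, ∫⁻ x, f t x ∂μ := by
  have hind : iIndepFun (fun t (z : Fin n → ℝ) => f t (z t)) (Measure.pi fun _ : Fin n => μ) :=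
    iIndepFun_pi (X := fun t => f t) fun t => (hf t).aemeasurable
  have := lintegral_prod_eq_prod_lintegral_of_indepFun Finset.univ
    (fun t (z : Fin n → ℝ) => f t (z t)) hind fun t => (hf t).comp (measurable_pi_apply t)
  rw [this]
  refine Finset.prod_congr rfl fun t _ => ?_
  exact (measurePreserving_eval (fun _ : Fin n => μ) t).lintegral_comp (hf t)

/-- The Bhattacharyya-type integral of two Gaussian densities at distance `e`. -/
lemma lintegral_gaussianReal_ratio {S : ℝ} (hS : 0 < S) (e : ℝ) :
    ∫⁻ z, ENNReal.ofReal (Real.exp (S / 4 * z ^ 2)) * gaussWeight (S / 4) (z - e)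
      ∂(gaussianReal 0 (1 / S).toNNReal) = gaussWeight (S / 8) e := by
  have h1 : ∀ z : ℝ, ENNReal.ofReal (Real.exp (S / 4 * z ^ 2)) * gaussWeight (S / 4) (z - e)
      = ENNReal.ofReal (Real.exp (-(S / 4) * e ^ 2))
        * ENNReal.ofReal (Real.exp ((S * e / 2) * z)) := by
    intro z
    rw [gaussWeight, ← ENNReal.ofReal_mul (Real.exp_pos _).le,
      ← ENNReal.ofReal_mul (Real.exp_pos _).le, ← Real.exp_add, ← Real.exp_add]
    congr 2
    ring
  simp_rw [h1]
  rw [lintegral_const_mul _ (by fun_prop), ← ofReal_integral_eq_lintegral_ofReal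
    (integrable_exp_mul_gaussianReal _) (ae_of_all _ fun x => (Real.exp_pos _).le)]
  have h2 : ∫ z, Real.exp ((S * e / 2) * z) ∂(gaussianReal 0 (1 / S).toNNReal)
      = Real.exp (S * e ^ 2 / 8) := by
    have := mgf_gaussianReal (X := id) (p := gaussianReal 0 (1 / S).toNNReal) (μ := 0)
      (v := (1 / S).toNNReal) (by simp) (S * e / 2)
    rw [mgf] at this
    simp only [id] at this
    rw [this, Real.coe_toNNReal _ (by positivity)]
    congr 1
    field_simp
    ring
  rw [h2, ← ENNReal.ofReal_mul (Real.exp_pos _).le, ← Real.exp_add, gaussWeight]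
  congr 2
  ring

lemma lintegral_gaussianReal_periodic {S : ℝ} (hS : 0 < S) (P e : ℝ) :
    ∫⁻ z, ENNReal.ofReal (Real.exp (S / 4 * z ^ 2)) * periodicGauss (S / 4) P (z - e)
      ∂(gaussianReal 0 (1 / S).toNNReal) = periodicGauss (S / 8) P e := by
  simp_rw [periodicGauss, ← ENNReal.tsum_mul_left]
  rw [lintegral_tsum]
  -- Reflecting the index turns the shift `z - e + P * a` into `z - (e + P * a)`, to which the
  -- single-Gaussian formula applies.
  · rw [← (Equiv.neg ℤ).tsum_eq]
    refine tsum_congr fun a => ?_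
    rw [← lintegral_gaussianReal_ratio hS]
    refine lintegral_congr fun z => ?_
    congr 2
    simp
    ring
  · intro a
    have h1 : Measurable fun z : ℝ => gaussWeight (S / 4) (z - e + P * a) :=
      (measurable_gaussWeight _).comp (by fun_prop)
    have h2 : Measurable fun z : ℝ => ENNReal.ofReal (Real.exp (S / 4 * z ^ 2)) := by fun_prop
    exact (h2.mul h1).aemeasurable

/-- A measurable choice of a maximizer of finitely many measurable scores. -/
lemma exists_measurable_argmax {X : Type*} [MeasurableSpace X] {M : ℕ} (hM : 0 < M)
    (s : Fin M → X → ℝ≥0∞) (hs : ∀ w, Measurable (s w)) :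
    ∃ g : X → Fin M, Measurable g ∧ ∀ x w, s w x ≤ s (g x) x := by
  classical
  have : Nonempty (Fin M) := ⟨⟨0, hM⟩⟩
  -- Ties are broken by the least index, which makes the choice measurable.
  have hex : ∀ x, ∃ N : ℕ, ∃ h : N < M, ∀ w, s w x ≤ s ⟨N, h⟩ x := by
    intro x
    obtain ⟨w, hw⟩ := Finite.exists_max fun w => s w x
    exact ⟨w, w.2, hw⟩
  refine ⟨fun x => ⟨Nat.find (hex x), (Nat.find_spec (hex x)).1⟩, ?_,
    fun x => (Nat.find_spec (hex x)).2⟩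
  have hmeas : Measurable fun x => Nat.find (hex x) := by
    refine measurable_find hex fun k => ?_
    by_cases hk : k < M
    · simp only [hk, exists_true_left]
      rw [Set.ofPred_forall]
      exact MeasurableSet.iInter fun w => measurableSet_le (hs w) (hs _)
    · simp [hk]
  refine measurable_to_countable' fun w => ?_
  have : (fun x => (⟨Nat.find (hex x), (Nat.find_spec (hex x)).1⟩ : Fin M)) ⁻¹' {w}
      = (fun x => Nat.find (hex x)) ⁻¹' {(w : ℕ)} := by
    ext x
    simp [Fin.ext_iff]
  rw [this]
  exact hmeas (measurableSet_singleton _)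

/-- A decoder for signals known up to `P ℤⁿ`, with a union bound on its error probability under
Gaussian noise of variance `1 / S`. The nuisance parameter `v` need not be decoded. -/
lemma exists_decoder {n M : ℕ} (hM : 0 < M) {V : Type*} [Fintype V] {S : ℝ} (hS : 0 < S) (P : ℝ)
    (σ : Fin M → V → Fin n → ℝ) :
    ∃ g : (Fin n → ℝ) → Fin M, Measurable g ∧ ∀ (w : Fin M) (v : V) (s : Fin n → ℝ)
      (_ : ∀ t, ∃ q : ℤ, s t = σ w v t + P * q),
      (Measure.pi fun _ : Fin n => gaussianReal 0 (1 / S).toNNReal)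
        {z | g (fun t => s t + z t) ≠ w}
        ≤ ∑ w' ∈ Finset.univ.erase w, ∑ v',
          ∏ t, periodicGauss (S / 8) P (σ w' v' t - σ w v t) := by
  -- The exponent `S / 4` is half that of the Gaussian density, so the summands are periodized
  -- square roots of likelihoods. Summing over `v` avoids having to decode the interference.
  let score : Fin M → (Fin n → ℝ) → ℝ≥0∞ := fun w y =>
    ∑ v, ∏ t, periodicGauss (S / 4) P (y t - σ w v t)
  have hscore : ∀ w, Measurable (score w) := fun w =>
    Finset.measurable_sum _ fun v _ => Finset.measurable_prod _ fun t _ =>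
      (measurable_periodicGauss _ _).comp (by fun_prop)
  obtain ⟨g, hg, hmax⟩ := exists_measurable_argmax hM score hscore
  refine ⟨g, hg, fun w v s hs => ?_⟩
  set μ := Measure.pi fun _ : Fin n => gaussianReal 0 (1 / S).toNNReal with hμ
  -- Normalizing by the weight of the actual noise gives the true message a score of at least `1`,
  -- already from the term `v' = v` and the zero translate.
  let e : ℝ → ℝ≥0∞ := fun z => ENNReal.ofReal (Real.exp (S / 4 * z ^ 2))
  have he : Measurable e := by fun_prop
  let F : Fin M → V → (Fin n → ℝ) → ℝ≥0∞ := fun w' v' z =>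
    ∏ t, (e (z t) * periodicGauss (S / 4) P (z t - (σ w' v' t - σ w v t)))
  have hfac : ∀ w' v', ∀ t, Measurable fun x : ℝ =>
      e x * periodicGauss (S / 4) P (x - (σ w' v' t - σ w v t)) := fun w' v' t =>
    he.mul ((measurable_periodicGauss _ _).comp (by fun_prop))
  have hF : ∀ w' v', Measurable (F w' v') := fun w' v' =>
    Finset.measurable_prod _ fun t _ => (hfac w' v' t).comp (measurable_pi_apply t)
  have hshift : ∀ (z : Fin n → ℝ) w' v' t, periodicGauss (S / 4) P (s t + z t - σ w' v' t)
      = periodicGauss (S / 4) P (z t - (σ w' v' t - σ w v t)) := by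
    intro z w' v' t
    obtain ⟨q, hq⟩ := hs t
    rw [← periodicGauss_add_int_mul _ _ (z t - (σ w' v' t - σ w v t)) q, hq]
    congr 1
    ring
  have hFscore : ∀ w' z, ∑ v', F w' v' z
      = (∏ t, e (z t)) * score w' (fun t => s t + z t) := by
    intro w' z
    simp only [F, score, Finset.mul_sum, Finset.prod_mul_distrib, hshift]
  have hself : ∀ z, 1 ≤ ∑ v', F w v' z := by
    intro z
    refine le_trans ?_ (Finset.single_le_sum (f := fun v' => F w v' z)
      (fun _ _ => zero_le) (Finset.mem_univ v))
    refine Finset.one_le_prod'' fun t => ?_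
    calc (1 : ℝ≥0∞) = e (z t) * gaussWeight (S / 4) (z t) := by
          simp only [e, gaussWeight]
          rw [← ENNReal.ofReal_mul (Real.exp_pos _).le, ← Real.exp_add]
          simp
      _ ≤ _ := by
          gcongr
          simpa using gaussWeight_le_periodicGauss (S / 4) P (z t)
  have hsub : {z | g (fun t => s t + z t) ≠ w}
      ⊆ {z | 1 ≤ ∑ w' ∈ Finset.univ.erase w, ∑ v', F w' v' z} := by
    intro z hz
    simp only [Set.mem_ofPred_eq] at hz ⊢
    refine le_trans ?_ (Finset.single_le_sum (f := fun w' => ∑ v', F w' v' z)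
      (fun _ _ => zero_le) (Finset.mem_erase.2 ⟨hz, Finset.mem_univ _⟩))
    refine (hself z).trans ?_
    simp only [hFscore]
    gcongr
    exact hmax _ _
  refine (measure_mono hsub).trans ?_
  have hmk := mul_meas_ge_le_lintegral (μ := μ)
    (f := fun z => ∑ w' ∈ Finset.univ.erase w, ∑ v', F w' v' z)
    (Finset.measurable_sum _ fun w' _ => Finset.measurable_sum _ fun v' _ => hF w' v') 1
  rw [one_mul] at hmk
  refine hmk.trans (le_of_eq ?_)
  rw [lintegral_finsetSum _ fun w' _ => Finset.measurable_sum _ fun v' _ => hF w' v']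
  refine Finset.sum_congr rfl fun w' _ => ?_
  rw [lintegral_finsetSum _ fun v' _ => hF w' v']
  refine Finset.sum_congr rfl fun v' _ => ?_
  rw [hμ, lintegral_pi_prod_eq_prod _ _ (hfac w' v')]
  exact Finset.prod_congr rfl fun t _ => lintegral_gaussianReal_periodic hS P _

/-! ### Diophantine separation and sums over residues -/

lemma diophDelta_nonneg (p : ℕ) (γ : ℝ) : 0 ≤ diophDelta p γ := by
  refine Real.sInf_nonneg ?_
  rintro _ ⟨l, -, rfl⟩
  positivity

/-- The quantity minimized in `diophDelta` is the distance from `l * γ` to the nearest integer,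
which is unchanged under `l ↦ -l`. This is how `diophDelta` enters, both as a separation and as a
distance. -/
lemma diophDelta_le_abs {p : ℕ} {γ : ℝ} {m : ℤ} (hm : m ≠ 0) (hmp : |m| < p) (q : ℤ) :
    diophDelta p γ ≤ |γ * m + q| := by
  have hbdd : BddBelow ((fun l : ℕ => (l : ℝ) * |γ - (round ((l : ℝ) * γ) : ℝ) / (l : ℝ)|) ''
      Set.Ico 1 p) := ⟨0, by rintro _ ⟨l, -, rfl⟩; positivity⟩
  have hl : m.natAbs ∈ Set.Ico 1 p := by
    rw [abs_lt] at hmp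
    constructor <;> omega
  refine (csInf_le hbdd ⟨m.natAbs, hl, rfl⟩).trans ?_
  have hl0 : (0 : ℝ) < (m.natAbs : ℝ) := by exact_mod_cast hl.1
  have h1 : (m.natAbs : ℝ) * |γ - (round ((m.natAbs : ℝ) * γ) : ℝ) / (m.natAbs : ℝ)|
      = |(m.natAbs : ℝ) * γ - round ((m.natAbs : ℝ) * γ)| := by
    nth_rewrite 1 [← abs_of_pos hl0]
    rw [← abs_mul]
    congr 1
    field_simp
  simp only
  rw [h1]
  rcases Int.natAbs_eq m with h | h
  · have h2 : (m : ℝ) = (m.natAbs : ℝ) := by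
      rw [Nat.cast_natAbs, Int.cast_inj, abs_of_nonneg (by omega)]
    have := round_le ((m.natAbs : ℝ) * γ) (-q)
    refine this.trans (le_of_eq ?_)
    rw [h2]
    congr 1
    push_cast
    ring
  · have h2 : (m : ℝ) = -(m.natAbs : ℝ) := by
      rw [Nat.cast_natAbs, abs_of_nonpos (by omega)]
      push_cast
      ring
    have := round_le ((m.natAbs : ℝ) * γ) q
    refine this.trans (le_of_eq ?_)
    rw [h2, ← abs_neg]
    congr 1
    ring

lemma diophDelta_le_half {p : ℕ} (hp : 1 < p) (γ : ℝ) : diophDelta p γ ≤ 1 / 2 := by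
  have h := diophDelta_le_abs (p := p) (γ := γ) (m := 1) one_ne_zero (by simpa using hp) (-round γ)
  refine h.trans ?_
  simpa [← sub_eq_add_neg] using abs_sub_round γ

lemma ZMod.abs_val_sub_val_lt {p : ℕ} [NeZero p] (a b : ZMod p) :
    |(a.val : ℤ) - b.val| < p := by
  have h1 := ZMod.val_lt a
  have h2 := ZMod.val_lt b
  rw [abs_lt]
  constructor <;> omega

/-- Two integers with the same residue modulo `p` give the same value of a `p`-periodic sum. -/
lemma periodicGauss_congr {α : ℝ} {p : ℕ} (x : ℝ) {a b : ℤ} (h : (a : ZMod p) = b) :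
    periodicGauss α p (x + a) = periodicGauss α p (x + b) := by
  obtain ⟨q, hq⟩ := (ZMod.intCast_eq_intCast_iff_dvd_sub a b p).1 h
  rw [← periodicGauss_add_int_mul α p (x + a) q]
  congr 1
  have : (b : ℝ) - a = p * q := by exact_mod_cast hq
  linarith

lemma sum_periodicGauss_eq_tsum {ι : Type*} [Fintype ι] (α P : ℝ) (x : ι → ℝ) :
    ∑ i, periodicGauss α P (x i) = ∑' ia : ι × ℤ, gaussWeight α (x ia.1 + P * ia.2) := by
  rw [ENNReal.tsum_prod (f := fun i (a : ℤ) => gaussWeight α (x i + P * a)), tsum_fintype]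
  rfl

/-- The numbers `b.val + p * a` run once through all integers, so the sum is over the `1`-separated
set `x + ℤ`, whose point nearest to `0` is `x - round x`. -/
lemma sum_periodicGauss_zmod_le {α : ℝ} (hα : 0 < α) {p : ℕ} [NeZero p] (x : ℝ) :
    ∑ b : ZMod p, periodicGauss α p (x + b.val)
      ≤ gaussWeight α (x - round x) + ENNReal.ofReal √(Real.pi / α) := by
  rw [sum_periodicGauss_eq_tsum]
  have hp : (p : ℤ) ≠ 0 := by exact_mod_cast NeZero.ne p
  obtain ⟨i₀, hi₀⟩ : ∃ i : ZMod p × ℤ, (i.1.val : ℤ) + p * i.2 = -round x := by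
    refine ⟨(((-round x : ℤ) : ZMod p), (-round x) / p), ?_⟩
    simp only [ZMod.val_intCast]
    exact Int.emod_add_mul_ediv _ _
  have hx₀ : x + (i₀.1.val : ℝ) + p * i₀.2 = x - round x := by
    have : ((i₀.1.val : ℝ) + p * i₀.2) = -round x := by exact_mod_cast hi₀
    linarith
  have := tsum_gaussWeight_le hα one_pos
    (fun i : ZMod p × ℤ => x + (i.1.val : ℝ) + p * i.2) ?_ i₀ ?_
  · rw [hx₀, div_one] at this
    exact this
  · rintro ⟨b, a⟩ ⟨b', a'⟩ hne
    have hint : ((b.val : ℤ) + p * a) - ((b'.val : ℤ) + p * a') ≠ 0 := by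
      intro h0
      have h1 := congrArg (Int.cast : ℤ → ZMod p) h0
      simp only [Int.cast_sub, Int.cast_add, Int.cast_natCast, ZMod.natCast_zmod_val,
        Int.cast_mul, CharP.cast_eq_zero, zero_mul, add_zero, Int.cast_zero] at h1
      have h2 : b = b' := sub_eq_zero.1 h1
      subst h2
      have h3 : (p : ℤ) * (a - a') = 0 := by linarith
      rcases mul_eq_zero.1 h3 with h | h
      · exact hp h
      · exact hne (by rw [sub_eq_zero.1 h])
    have h1 : (1 : ℤ) ≤ |((b.val : ℤ) + p * a) - ((b'.val : ℤ) + p * a')| :=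
      Int.one_le_abs hint
    have h2 : (1 : ℝ) ≤ |(((b.val : ℝ) + p * a) - ((b'.val : ℝ) + p * a'))| := by exact_mod_cast h1
    refine h2.trans (le_of_eq ?_)
    congr 1
    ring
  · rintro ⟨b, a⟩
    simp only
    rw [hx₀]
    refine (round_le x (-((b.val : ℤ) + p * a))).trans (le_of_eq ?_)
    push_cast
    congr 1
    ring

/-- Points with distinct residues differ by `γ * m` plus an integer, with `0 < |m| < p`, hence by at
least `diophDelta`. Points with equal residues differ by at least `p`. The smallest point is `0`,
attained at `c' = c`. -/
lemma sum_periodicGauss_line_le {α : ℝ} (hα : 0 < α) {p : ℕ} (hp : 1 < p) [NeZero p] {γ : ℝ}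
    (hδ : 0 < diophDelta p γ) (l : ℤ) (c : ZMod p) :
    ∑ c' : ZMod p, periodicGauss α p ((γ + l) * ((c'.val : ℝ) - c.val))
      ≤ 1 + ENNReal.ofReal (√(Real.pi / α) / diophDelta p γ) := by
  rw [sum_periodicGauss_eq_tsum]
  have := tsum_gaussWeight_le hα hδ
    (fun i : ZMod p × ℤ => (γ + l) * ((i.1.val : ℝ) - c.val) + p * i.2) ?_ (c, 0) ?_
  · simpa [gaussWeight] using this
  · rintro ⟨b, a⟩ ⟨b', a'⟩ hne
    simp only
    by_cases hb : b = b'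
    · subst hb
      have ha : a - a' ≠ 0 := by
        intro h
        exact hne (by rw [sub_eq_zero.1 h])
      have h1 : (1 : ℝ) ≤ |(a : ℝ) - a'| := by exact_mod_cast Int.one_le_abs ha
      have h2 : (1 : ℝ) ≤ p := by exact_mod_cast hp.le
      have h3 := diophDelta_le_half hp γ
      rw [add_sub_add_left_eq_sub, ← mul_sub, abs_mul, abs_of_nonneg (by linarith : (0 : ℝ) ≤ p)]
      nlinarith
    · have hm : (b.val : ℤ) - b'.val ≠ 0 := by
        intro h
        exact hb (ZMod.val_injective p (by omega))
      refine (diophDelta_le_abs hm (ZMod.abs_val_sub_val_lt b b')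
        (l * ((b.val : ℤ) - b'.val) + p * (a - a'))).trans (le_of_eq ?_)
      push_cast
      congr 1
      ring
  · rintro ⟨b, a⟩
    simp

/-! ### Uniform images under surjective homomorphisms -/

/-- All fibres of a surjective homomorphism have the same size, so it carries the uniform law to the
uniform law. -/
lemma AddMonoidHom.card_mul_sum_comp {A B R : Type*} [AddGroup A] [AddGroup B] [Fintype A]
    [Fintype B] [CommSemiring R] (φ : A →+ B) (hφ : Function.Surjective φ) (F : B → R) :
    (Fintype.card B : R) * ∑ a, F (φ a) = Fintype.card A * ∑ b, F b := by
  classical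
  have hfib : ∀ b, (Finset.univ.filter fun a => φ a = b).card
      = (Finset.univ.filter fun a => φ a = 0).card := fun b =>
    AddMonoidHom.card_fiber_eq_of_mem_range φ (hφ b) (hφ 0)
  have hcard : Fintype.card A
      = Fintype.card B * (Finset.univ.filter fun a => φ a = 0).card := by
    rw [← Finset.card_univ, Finset.card_eq_sum_card_fiberwise (f := φ) (t := Finset.univ)
      (fun _ _ => Finset.mem_coe.2 (Finset.mem_univ _)), Finset.sum_congr rfl fun b _ => hfib b]
    simp
  have hsum : ∑ a, F (φ a) = (Finset.univ.filter fun a => φ a = 0).card * ∑ b, F b := by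
    rw [← Finset.sum_fiberwise (s := Finset.univ) (g := φ), Finset.mul_sum]
    refine Finset.sum_congr rfl fun b _ => ?_
    rw [← hfib b, ← nsmul_eq_mul]
    refine Finset.sum_eq_card_nsmul fun a ha => ?_
    rw [(Finset.mem_filter.1 ha).2]
  rw [hsum, hcard]
  push_cast
  ring

section Linear

variable {F : Type*} [Field F] {m : ℕ}

/-- The additive map `r ↦ r ⬝ a`. -/
def dotHom (a : Fin m → F) : (Fin m → F) →+ F where
  toFun r := r ⬝ᵥ a
  map_zero' := zero_dotProduct a
  map_add' r s := add_dotProduct r s a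

lemma dotHom_surjective {a : Fin m → F} (ha : a ≠ 0) : Function.Surjective (dotHom a) := by
  obtain ⟨i, hi⟩ := Function.ne_iff.1 ha
  intro s
  refine ⟨Pi.single i (s / a i), ?_⟩
  simp only [dotHom, AddMonoidHom.coe_mk, ZeroHom.coe_mk, single_dotProduct]
  exact div_mul_cancel₀ s hi

/-- Two vectors that are not proportional have a nonzero `2 × 2` minor, at coordinates `i` and `k`;
a row supported there attains any prescribed pair of values. -/
lemma dotHom_prod_surjective {a b : Fin m → F} (ha : a ≠ 0) (hb : ∀ l : F, b ≠ l • a) :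
    Function.Surjective ((dotHom a).prod (dotHom b)) := by
  obtain ⟨i, hi⟩ := Function.ne_iff.1 ha
  obtain ⟨k, hk⟩ := Function.ne_iff.1 (hb (b i / a i))
  simp only [Pi.zero_apply, Pi.smul_apply, smul_eq_mul] at hi hk
  have hk' : b k - b i / a i * a k ≠ 0 := sub_ne_zero.2 hk
  rintro ⟨s, τ⟩
  set y := (τ - b i / a i * s) / (b k - b i / a i * a k) with hy
  have hy' : y * (b k - b i / a i * a k) = τ - b i / a i * s := div_mul_cancel₀ _ hk'
  refine ⟨Pi.single i ((s - y * a k) / a i) + Pi.single k y, ?_⟩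
  simp only [dotHom, AddMonoidHom.prod_apply, AddMonoidHom.coe_mk, ZeroHom.coe_mk,
    add_dotProduct, single_dotProduct, Prod.mk.injEq]
  constructor
  · rw [div_mul_cancel₀ _ hi]
    ring
  · field_simp at hy' ⊢
    linear_combination hy'

end Linear

/-! ### Pairwise error sums for one channel use -/

/-- The argument of the logarithm in `rateTermOne`. -/
def rateArgOne (SNR : ℝ) (p : ℕ) (γ : ℝ) : ℝ :=
  1 / (p : ℝ) ^ 2 + √((2 * Real.pi / 3) / SNR)
    + (1 / (p : ℝ)) * Real.exp (-(3 * SNR / (2 * (p : ℝ) ^ 2)) * (diophDelta p γ) ^ 2)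
    + 2 * Real.exp (-(3 * SNR / 8))

/-- The argument of the logarithm in `rateTermTwo`, for `diophDelta p γ ≠ 0`. -/
def rateArgTwo (SNR : ℝ) (p : ℕ) (γ : ℝ) : ℝ :=
  1 / (p : ℝ) + √((2 * Real.pi / 3) / ((diophDelta p γ) ^ 2 * SNR))
    + 2 * Real.exp (-(3 * SNR / 8))

lemma rateArgOne_pos (SNR : ℝ) (p : ℕ) (γ : ℝ) : 0 < rateArgOne SNR p γ := by
  unfold rateArgOne; positivity

lemma rateArgTwo_pos (SNR : ℝ) (p : ℕ) (γ : ℝ) : 0 < rateArgTwo SNR p γ := by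
  unfold rateArgTwo; positivity

/-- The factor that one channel use contributes to the pairwise error bound, when the residue sent
is `c`, that of the competing codeword is `c + s`, and the interference residues differ by `b`. -/
def pairFactor (SNR : ℝ) (p : ℕ) (γ : ℝ) (c s b : ZMod p) : ℝ≥0∞ :=
  periodicGauss (3 * SNR / (2 * (p : ℝ) ^ 2)) p (γ * (((c + s).val : ℝ) - c.val) + b.val)

lemma sqrt_pi_div_eq {SNR : ℝ} {p : ℕ} (hp : 0 < p) :
    √(Real.pi / (3 * SNR / (2 * (p : ℝ) ^ 2))) = p * √((2 * Real.pi / 3) / SNR) := by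
  have hp' : (0 : ℝ) < p := by exact_mod_cast hp
  rw [← Real.sqrt_sq hp'.le, ← Real.sqrt_mul (by positivity), Real.sqrt_sq hp'.le]
  congr 1
  field_simp

/-- Summing over `b` fills all integer shifts and leaves one Gaussian at the distance from `γ * m`
to `ℤ`. It is at most `1` for `s = 0` and at most `E` for `s ≠ 0`, where that distance is at least
`diophDelta`. The total over `c` and `s` is `p + p ^ 2 * E + p ^ 3 * Q`. -/
lemma sum_pairFactor_le_one {SNR : ℝ} (hS : 0 < SNR) {p : ℕ} [NeZero p] (γ : ℝ) :
    ∑ c, ∑ sb : ZMod p × ZMod p, pairFactor SNR p γ c sb.1 sb.2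
      ≤ ENNReal.ofReal ((p : ℝ) ^ 3 * rateArgOne SNR p γ) := by
  have hp : (0 : ℝ) < p := by exact_mod_cast NeZero.pos p
  set α := 3 * SNR / (2 * (p : ℝ) ^ 2) with hα
  have hα0 : 0 < α := by positivity
  set E := Real.exp (-α * (diophDelta p γ) ^ 2) with hE
  set Q := √((2 * Real.pi / 3) / SNR) with hQ
  have hinner : ∀ c s : ZMod p, ∑ b, pairFactor SNR p γ c s b
      ≤ ENNReal.ofReal ((if s = 0 then 1 else 0) + E + p * Q) := by
    intro c s
    refine (sum_periodicGauss_zmod_le hα0 _).trans ?_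
    rw [hα, sqrt_pi_div_eq (NeZero.pos p), ← hα, gaussWeight,
      ← ENNReal.ofReal_add (Real.exp_pos _).le (by positivity)]
    refine ENNReal.ofReal_le_ofReal ?_
    gcongr
    split_ifs with h
    · refine le_trans (Real.exp_le_one_iff.2 ?_) (le_add_of_nonneg_right (Real.exp_pos _).le)
      nlinarith [sq_nonneg (γ * (((c + s).val : ℝ) - c.val)
        - round (γ * (((c + s).val : ℝ) - c.val)))]
    · rw [zero_add, hE, Real.exp_le_exp]
      have hm : ((c + s).val : ℤ) - c.val ≠ 0 := by
        intro h0
        have : (c + s) = c := ZMod.val_injective p (by omega)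
        exact h (by simpa using this)
      have h1 := diophDelta_le_abs (γ := γ) hm (ZMod.abs_val_sub_val_lt (c + s) c)
        (-round (γ * (((c + s).val : ℝ) - c.val)))
      push_cast at h1
      rw [← sub_eq_add_neg] at h1
      have h2 := pow_le_pow_left₀ (diophDelta_nonneg p γ) h1 2
      rw [sq_abs] at h2
      nlinarith
  calc ∑ c, ∑ sb : ZMod p × ZMod p, pairFactor SNR p γ c sb.1 sb.2
      ≤ ∑ c : ZMod p, ∑ s : ZMod p, ENNReal.ofReal ((if s = 0 then 1 else 0) + E + p * Q) := by
        refine Finset.sum_le_sum fun c _ => ?_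
        rw [Fintype.sum_prod_type]
        exact Finset.sum_le_sum fun s _ => hinner c s
    _ = ENNReal.ofReal (∑ c : ZMod p, ∑ s : ZMod p, ((if s = 0 then 1 else 0) + E + p * Q)) := by
        rw [ENNReal.ofReal_sum_of_nonneg fun c _ => Finset.sum_nonneg fun s _ => by positivity]
        refine Finset.sum_congr rfl fun c _ => ?_
        rw [ENNReal.ofReal_sum_of_nonneg fun s _ => by positivity]
    _ ≤ _ := by
        refine ENNReal.ofReal_le_ofReal ?_
        simp only [Finset.sum_add_distrib, Finset.sum_ite_eq', Finset.mem_univ, if_true,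
          Finset.sum_const, Finset.card_univ, ZMod.card, nsmul_eq_mul]
        have h1 : (p : ℝ) ^ 3 * rateArgOne SNR p γ = p + p ^ 2 * E + p ^ 3 * Q
            + p ^ 3 * (2 * Real.exp (-(3 * SNR / 8))) := by
          rw [rateArgOne, ← hα, ← hE, ← hQ]
          field_simp
          ring
        rw [h1]
        -- The last summand of `rateArgOne` is only slack for this estimate.
        have h2 : 0 ≤ (p : ℝ) ^ 3 * (2 * Real.exp (-(3 * SNR / 8))) := by positivity
        nlinarith

lemma sum_pairFactor_le_two {SNR : ℝ} (hS : 0 < SNR) {p : ℕ} (hp1 : 1 < p) [NeZero p] {γ : ℝ}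
    (hδ : 0 < diophDelta p γ) (l : ZMod p) :
    ∑ c, ∑ s : ZMod p, pairFactor SNR p γ c s (l * s)
      ≤ ENNReal.ofReal ((p : ℝ) ^ 2 * rateArgTwo SNR p γ) := by
  have hp : (0 : ℝ) < p := by exact_mod_cast NeZero.pos p
  set α := 3 * SNR / (2 * (p : ℝ) ^ 2) with hα
  have hα0 : 0 < α := by positivity
  set Q := √((2 * Real.pi / 3) / SNR) with hQ
  have hinner : ∀ c : ZMod p, ∑ s, pairFactor SNR p γ c s (l * s)
      ≤ ENNReal.ofReal (1 + p * Q / diophDelta p γ) := by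
    intro c
    have h1 : ∑ s, pairFactor SNR p γ c s (l * s)
        = ∑ c' : ZMod p, periodicGauss α p ((γ + (l.val : ℤ)) * ((c'.val : ℝ) - c.val)) := by
      -- With `c' = c + s`, the residue `l * s` may be replaced modulo `p` by the integer `l.val *
      -- (c'.val - c.val)`, which merges with the direct gain into the slope `γ + l.val`.
      rw [← Equiv.sum_comp (Equiv.addLeft c)
        fun c' => periodicGauss α p ((γ + (l.val : ℤ)) * ((c'.val : ℝ) - c.val))]
      refine Finset.sum_congr rfl fun s _ => ?_
      simp only [Equiv.coe_addLeft, pairFactor]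
      have := periodicGauss_congr (α := α) (p := p) (γ * (((c + s).val : ℝ) - c.val))
        (a := ((l * s).val : ℤ)) (b := (l.val : ℤ) * (((c + s).val : ℤ) - c.val)) (by simp)
      rw [← hα]
      push_cast at this ⊢
      rw [this]
      congr 1
      ring
    rw [h1]
    refine (sum_periodicGauss_line_le hα0 hp1 hδ _ c).trans ?_
    rw [hα, sqrt_pi_div_eq (NeZero.pos p), ENNReal.ofReal_add zero_le_one (by positivity),
      ENNReal.ofReal_one]
  calc ∑ c, ∑ s : ZMod p, pairFactor SNR p γ c s (l * s)
      ≤ ∑ _ : ZMod p, ENNReal.ofReal (1 + p * Q / diophDelta p γ) :=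
        Finset.sum_le_sum fun c _ => hinner c
    _ = ENNReal.ofReal (∑ _ : ZMod p, (1 + p * Q / diophDelta p γ)) := by
        rw [ENNReal.ofReal_sum_of_nonneg fun c _ => by positivity]
    _ ≤ _ := by
        refine ENNReal.ofReal_le_ofReal ?_
        have h3 : √((2 * Real.pi / 3) / ((diophDelta p γ) ^ 2 * SNR)) = Q / diophDelta p γ := by
          rw [hQ, mul_comm (diophDelta p γ ^ 2), ← div_div, Real.sqrt_div' _ (by positivity), Real.sqrt_sq hδ.le]
        have h1 : (p : ℝ) ^ 2 * rateArgTwo SNR p γ = p * (1 + p * Q / diophDelta p γ)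
            + p ^ 2 * (2 * Real.exp (-(3 * SNR / 8))) := by
          rw [rateArgTwo, h3]
          field_simp
        have h2 : 0 ≤ (p : ℝ) ^ 2 * (2 * Real.exp (-(3 * SNR / 8))) := by positivity
        rw [h1]
        simp only [Finset.sum_const, Finset.card_univ, ZMod.card, nsmul_eq_mul]
        linarith

/-! ### Averaging one channel use over row and dither -/

section Average

variable {SNR : ℝ} {p : ℕ} [Fact p.Prime] {m : ℕ} {γ : ℝ}

/-- Averaging over a uniform row `r` and a uniform dither `d`: independent differences. -/
lemma sum_row_le_of_independent (hS : 0 < SNR) (u a b : Fin m → ZMod p) (ha : a ≠ 0)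
    (hb : ∀ l : ZMod p, b ≠ l • a) :
    ∑ rd : (Fin m → ZMod p) × ZMod p,
      pairFactor SNR p γ (rd.1 ⬝ᵥ u + rd.2) (rd.1 ⬝ᵥ a) (rd.1 ⬝ᵥ b)
      ≤ (p : ℝ≥0∞) ^ (m + 1) * ENNReal.ofReal (rateArgOne SNR p γ) := by
  have hp0 : (p : ℝ≥0∞) ^ 2 ≠ 0 := by simp [NeZero.ne p]
  have hpt : (p : ℝ≥0∞) ^ 2 ≠ ∞ := by simp
  have h1 : ∑ rd : (Fin m → ZMod p) × ZMod p,
      pairFactor SNR p γ (rd.1 ⬝ᵥ u + rd.2) (rd.1 ⬝ᵥ a) (rd.1 ⬝ᵥ b)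
      = ∑ c, ∑ r : Fin m → ZMod p, pairFactor SNR p γ c (r ⬝ᵥ a) (r ⬝ᵥ b) := by
    rw [Fintype.sum_prod_type, Finset.sum_comm (s := (Finset.univ : Finset (ZMod p)))]
    refine Finset.sum_congr rfl fun r _ => ?_
    -- For a fixed row the dither makes the sent residue `c` uniform, independently of the two
    -- differences.
    exact Equiv.sum_comp (Equiv.addLeft (r ⬝ᵥ u))
      fun c => pairFactor SNR p γ c (r ⬝ᵥ a) (r ⬝ᵥ b)
  rw [h1, ← ENNReal.mul_le_mul_iff_right hp0 hpt, Finset.mul_sum]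
  calc ∑ c, (p : ℝ≥0∞) ^ 2 * ∑ r : Fin m → ZMod p, pairFactor SNR p γ c (r ⬝ᵥ a) (r ⬝ᵥ b)
      = ∑ c, (p : ℝ≥0∞) ^ m * ∑ sb : ZMod p × ZMod p, pairFactor SNR p γ c sb.1 sb.2 := by
        refine Finset.sum_congr rfl fun c _ => ?_
        have := AddMonoidHom.card_mul_sum_comp _ (dotHom_prod_surjective ha hb)
          fun sb : ZMod p × ZMod p => pairFactor SNR p γ c sb.1 sb.2
        simp only [Fintype.card_prod, ZMod.card, Fintype.card_fun, Fintype.card_fin,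
          Nat.cast_pow, ← sq] at this
        exact this
    _ ≤ (p : ℝ≥0∞) ^ m * ENNReal.ofReal ((p : ℝ) ^ 3 * rateArgOne SNR p γ) := by
        rw [← Finset.mul_sum]
        gcongr
        exact sum_pairFactor_le_one hS γ
    _ = _ := by
        rw [ENNReal.ofReal_mul (by positivity), ENNReal.ofReal_pow (by positivity),
          ENNReal.ofReal_natCast]
        ring

/-- Averaging over a uniform row `r` and a uniform dither `d`: proportional differences. -/
lemma sum_row_le_of_proportional (hS : 0 < SNR) (hδ : 0 < diophDelta p γ)
    (u a : Fin m → ZMod p) (ha : a ≠ 0) (l : ZMod p) :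
    ∑ rd : (Fin m → ZMod p) × ZMod p,
      pairFactor SNR p γ (rd.1 ⬝ᵥ u + rd.2) (rd.1 ⬝ᵥ a) (rd.1 ⬝ᵥ (l • a))
      ≤ (p : ℝ≥0∞) ^ (m + 1) * ENNReal.ofReal (rateArgTwo SNR p γ) := by
  have hp0 : (p : ℝ≥0∞) ≠ 0 := by simp [NeZero.ne p]
  have hpt : (p : ℝ≥0∞) ≠ ∞ := by simp
  have h1 : ∑ rd : (Fin m → ZMod p) × ZMod p,
      pairFactor SNR p γ (rd.1 ⬝ᵥ u + rd.2) (rd.1 ⬝ᵥ a) (rd.1 ⬝ᵥ (l • a))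
      = ∑ c, ∑ r : Fin m → ZMod p, pairFactor SNR p γ c (r ⬝ᵥ a) (l * (r ⬝ᵥ a)) := by
    rw [Fintype.sum_prod_type, Finset.sum_comm (s := (Finset.univ : Finset (ZMod p)))]
    refine Finset.sum_congr rfl fun r _ => ?_
    simp only [dotProduct_smul, smul_eq_mul]
    exact Equiv.sum_comp (Equiv.addLeft (r ⬝ᵥ u))
      fun c => pairFactor SNR p γ c (r ⬝ᵥ a) (l * (r ⬝ᵥ a))
  rw [h1, ← ENNReal.mul_le_mul_iff_right hp0 hpt, Finset.mul_sum]
  calc ∑ c, (p : ℝ≥0∞) * ∑ r : Fin m → ZMod p, pairFactor SNR p γ c (r ⬝ᵥ a) (l * (r ⬝ᵥ a))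
      = ∑ c, (p : ℝ≥0∞) ^ m * ∑ s : ZMod p, pairFactor SNR p γ c s (l * s) := by
        refine Finset.sum_congr rfl fun c _ => ?_
        have := AddMonoidHom.card_mul_sum_comp _ (dotHom_surjective ha)
          fun s : ZMod p => pairFactor SNR p γ c s (l * s)
        simp only [ZMod.card, Fintype.card_fun, Fintype.card_fin, Nat.cast_pow] at this
        exact this
    _ ≤ (p : ℝ≥0∞) ^ m * ENNReal.ofReal ((p : ℝ) ^ 2 * rateArgTwo SNR p γ) := by
        rw [← Finset.mul_sum]
        gcongr
        exact sum_pairFactor_le_two hS (Fact.out : p.Prime).one_lt hδ l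
    _ = _ := by
        rw [ENNReal.ofReal_mul (by positivity), ENNReal.ofReal_pow (by positivity),
          ENNReal.ofReal_natCast]
        ring

end Average

/-! ### The dithered linear code and its ensemble averages -/

/-- The point of a centred `p`-point constellation of step `√12 / p` with label `c`. -/
def codeSymbol (p : ℕ) (c : ZMod p) : ℝ := √12 / p * ((c.val : ℝ) - ((p : ℝ) - 1) / 2)

lemma sum_range_sq_sub (p : ℕ) (c : ℝ) : ∑ i ∈ Finset.range p, ((i : ℝ) - c) ^ 2
    = (p : ℝ) * (p - 1) * (2 * p - 1) / 6 - c * (p * (p - 1)) + p * c ^ 2 := by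
  induction p with
  | zero => simp
  | succ k ih =>
    rw [Finset.sum_range_succ, ih]
    push_cast
    ring

lemma sum_codeSymbol_sq (p : ℕ) [NeZero p] :
    ∑ c, codeSymbol p c ^ 2 = p * (1 - 1 / (p : ℝ) ^ 2) := by
  have hp : (p : ℝ) ≠ 0 := by exact_mod_cast NeZero.ne p
  have h1 : ∑ c : ZMod p, ((c.val : ℝ) - ((p : ℝ) - 1) / 2) ^ 2
      = ∑ i ∈ Finset.range p, ((i : ℝ) - ((p : ℝ) - 1) / 2) ^ 2 := by
    obtain ⟨k, rfl⟩ := Nat.exists_eq_succ_of_ne_zero (NeZero.ne p)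
    exact Fin.sum_univ_eq_sum_range
      (fun i : ℕ => ((i : ℝ) - (((k + 1 : ℕ) : ℝ) - 1) / 2) ^ 2) (k + 1)
  simp only [codeSymbol, mul_pow, ← Finset.mul_sum]
  rw [h1, sum_range_sq_sub, div_pow, Real.sq_sqrt (by norm_num)]
  field_simp
  ring

/-- Generator rows and dithers of a linear code of length `n` and dimension `m` over `ZMod p`. -/
abbrev DitheredCode (p m n : ℕ) : Type := Fin n → (Fin m → ZMod p) × ZMod p

section Code

variable {p m n : ℕ}

/-- The codeword of the message vector `u`. -/
def DitheredCode.enc (ω : DitheredCode p m n) (u : Fin m → ZMod p) (t : Fin n) : ℝ :=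
  codeSymbol p ((ω t).1 ⬝ᵥ u + (ω t).2)

/-- The noiseless signal, up to multiples of `√12`, at a receiver with direct gain `γ` and integer
cross gains of sum `A`, when the desired message is `u` and the aligned interference is `v`. -/
def DitheredCode.signal (ω : DitheredCode p m n) (γ : ℝ) (A : ℤ) (u v : Fin m → ZMod p)
    (t : Fin n) : ℝ :=
  γ * ω.enc u t
    + √12 / p * ((((ω t).1 ⬝ᵥ v + A * (ω t).2).val : ℝ) - A * (((p : ℝ) - 1) / 2))

lemma DitheredCode.card [NeZero p] :
    Fintype.card (DitheredCode p m n) = (p ^ (m + 1)) ^ n := by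
  simp [pow_succ]

lemma DitheredCode.sum_enc_sq [NeZero p] (u : Fin m → ZMod p) (t : Fin n) :
    ∑ ω : DitheredCode p m n, ω.enc u t ^ 2
      = Fintype.card (DitheredCode p m n) * (1 - 1 / (p : ℝ) ^ 2) := by
  have hp : (p : ℝ) ≠ 0 := by exact_mod_cast NeZero.ne p
  let φ : DitheredCode p m n →+ ZMod p :=
    { toFun := fun ω => (ω t).1 ⬝ᵥ u + (ω t).2
      map_zero' := by simp
      map_add' := fun ω ω' => by simp [add_dotProduct]; ring }
  have hφ : Function.Surjective φ := fun c => ⟨fun _ => (0, c), by simp [φ]⟩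
  have := AddMonoidHom.card_mul_sum_comp φ hφ fun c => codeSymbol p c ^ 2
  rw [sum_codeSymbol_sq, ZMod.card] at this
  refine mul_left_cancel₀ hp (Eq.trans this ?_)
  ring

/-- Interference alignment: an integer combination of residues is determined modulo `p` by the same
combination of message vectors and dithers, and `p` steps of the constellation make up `√12`. The
direct gain is real, so the desired symbol is not reduced. -/
lemma DitheredCode.sum_gain_mul_enc [NeZero p] (ω : DitheredCode p m n) {K : ℕ}
    (γ : ℝ) (a : Fin K → ℤ) (u : Fin m → ZMod p) (x : Fin K → Fin m → ZMod p) (t : Fin n) :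
    ∃ q : ℤ, γ * ω.enc u t + ∑ k, (a k : ℝ) * ω.enc (x k) t
      = ω.signal γ (∑ k, a k) u (∑ k, a k • x k) t + √12 * q := by
  have hp : (p : ℝ) ≠ 0 := by exact_mod_cast NeZero.ne p
  set c : Fin K → ZMod p := fun k => (ω t).1 ⬝ᵥ x k + (ω t).2 with hc
  set s : ZMod p := (ω t).1 ⬝ᵥ (∑ k, a k • x k) + ((∑ k, a k : ℤ) : ZMod p) * (ω t).2 with hs
  have hmod : ((s.val : ℤ) : ZMod p) = ((∑ k, a k * (c k).val : ℤ) : ZMod p) := by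
    simp only [Int.cast_natCast, ZMod.natCast_zmod_val, Int.cast_sum, Int.cast_mul, hs, hc,
      dotProduct_sum, mul_add, Finset.sum_add_distrib, Finset.sum_mul]
    congr 1
    refine Finset.sum_congr rfl fun k _ => ?_
    rw [dotProduct_smul, zsmul_eq_mul]
  obtain ⟨q, hq⟩ := (ZMod.intCast_eq_intCast_iff_dvd_sub _ _ p).1 hmod
  have hq' : ∑ k, (a k : ℝ) * ((c k).val : ℝ) = s.val + p * q := by
    have : (∑ k, (a k : ℝ) * ((c k).val : ℝ)) - s.val = p * q := by exact_mod_cast hq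
    linarith
  refine ⟨q, ?_⟩
  have hsum : ∑ k, (a k : ℝ) * ω.enc (x k) t
      = √12 / p * (∑ k, (a k : ℝ) * ((c k).val : ℝ) - (∑ k, (a k : ℝ)) * (((p : ℝ) - 1) / 2)) := by
    rw [Finset.sum_mul, ← Finset.sum_sub_distrib, Finset.mul_sum]
    refine Finset.sum_congr rfl fun k _ => ?_
    rw [DitheredCode.enc, codeSymbol, hc]
    ring
  rw [hsum, hq', DitheredCode.signal, ← hs]
  push_cast
  field_simp
  ring

/-- Scaling by `√12 / p` turns the period `√12` into `p` and the exponent `SNR / 8` into `3 * SNR /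
(2 * p ^ 2)`. The dither cancels modulo `p` in the interference difference. It stays in the desired
part, where a real gain multiplies a difference of representatives. -/
lemma DitheredCode.periodicGauss_signal_sub [NeZero p] (ω : DitheredCode p m n) (SNR γ : ℝ)
    (A : ℤ) (u u' v v' : Fin m → ZMod p) (t : Fin n) :
    periodicGauss (SNR / 8) √12 (ω.signal γ A u' v' t - ω.signal γ A u v t)
      = pairFactor SNR p γ ((ω t).1 ⬝ᵥ u + (ω t).2) ((ω t).1 ⬝ᵥ (u' - u))
        ((ω t).1 ⬝ᵥ (v' - v)) := by
  have hp : (p : ℝ) ≠ 0 := by exact_mod_cast NeZero.ne p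
  rcases hω : ω t with ⟨r, d⟩
  have h1 : (√12 : ℝ) = √12 / p * p := by field_simp
  have h2 : ω.signal γ A u' v' t - ω.signal γ A u v t
      = √12 / p * (γ * (((r ⬝ᵥ u' + d).val : ℝ) - (r ⬝ᵥ u + d).val)
        + (((r ⬝ᵥ v' + A * d).val : ℤ) - ((r ⬝ᵥ v + A * d).val : ℤ) : ℤ)) := by
    simp only [DitheredCode.signal, DitheredCode.enc, codeSymbol, hω]
    push_cast
    ring
  have h3 : SNR / 8 * (√12 / p) ^ 2 = 3 * SNR / (2 * (p : ℝ) ^ 2) := by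
    rw [div_pow, Real.sq_sqrt (by norm_num)]
    field_simp
    ring
  have h4 : r ⬝ᵥ u + d + r ⬝ᵥ (u' - u) = r ⬝ᵥ u' + d := by
    rw [dotProduct_sub]; ring
  have h5 := periodicGauss_congr (α := 3 * SNR / (2 * (p : ℝ) ^ 2)) (p := p)
    (γ * (((r ⬝ᵥ u' + d).val : ℝ) - (r ⬝ᵥ u + d).val))
    (a := ((r ⬝ᵥ v' + A * d).val : ℤ) - ((r ⬝ᵥ v + A * d).val : ℤ))
    (b := ((r ⬝ᵥ (v' - v)).val : ℤ)) (by simp [dotProduct_sub])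
  rw [h2]
  nth_rewrite 1 [h1]
  rw [periodicGauss_mul, h3, h5, pairFactor, h4, Int.cast_natCast]

variable [Fact p.Prime] {SNR γ : ℝ}

/-- Independent rows and dithers make the average of the product an `n`-th power. The proportional
case is kept as a sum of indicators over `l`, so that summing over `v'` later costs a factor `p`
there instead of `p ^ m`. -/
lemma DitheredCode.sum_prod_le (hS : 0 < SNR) (hδ : 0 < diophDelta p γ) (A : ℤ)
    (u u' v v' : Fin m → ZMod p) (hu : u' ≠ u) :
    ∑ ω : DitheredCode p m n, ∏ t,
        periodicGauss (SNR / 8) √12 (ω.signal γ A u' v' t - ω.signal γ A u v t)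
      ≤ Fintype.card (DitheredCode p m n) * (ENNReal.ofReal (rateArgOne SNR p γ) ^ n
        + ∑ l : ZMod p, if v' = l • (u' - u) + v then ENNReal.ofReal (rateArgTwo SNR p γ) ^ n
          else 0) := by
  simp only [DitheredCode.periodicGauss_signal_sub]
  rw [← Fintype.sum_pow (fun rd : (Fin m → ZMod p) × ZMod p => pairFactor SNR p γ
    (rd.1 ⬝ᵥ u + rd.2) (rd.1 ⬝ᵥ (u' - u)) (rd.1 ⬝ᵥ (v' - v))) n, DitheredCode.card]
  have ha : u' - u ≠ 0 := sub_ne_zero.2 hu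
  push_cast
  by_cases hex : ∃ l : ZMod p, v' - v = l • (u' - u)
  · obtain ⟨l, hl⟩ := hex
    calc _ ≤ ((p : ℝ≥0∞) ^ (m + 1) * ENNReal.ofReal (rateArgTwo SNR p γ)) ^ n := by
          gcongr
          rw [hl]
          exact sum_row_le_of_proportional hS hδ u _ ha l
      _ ≤ _ := by
          rw [mul_pow]
          gcongr
          refine le_trans ?_ le_add_self
          refine le_trans ?_ (Finset.single_le_sum (fun _ _ => zero_le) (Finset.mem_univ l))
          rw [if_pos (by rw [← hl, sub_add_cancel])]
  · push Not at hex
    calc _ ≤ ((p : ℝ≥0∞) ^ (m + 1) * ENNReal.ofReal (rateArgOne SNR p γ)) ^ n := by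
          gcongr
          exact sum_row_le_of_independent hS u _ _ ha hex
      _ ≤ _ := by
          rw [mul_pow]
          gcongr
          exact le_self_add

lemma DitheredCode.sum_union_bound_le (hS : 0 < SNR) (hδ : 0 < diophDelta p γ) (A : ℤ) {M : ℕ}
    (u : Fin M ↪ (Fin m → ZMod p)) (w : Fin M) (v : Fin m → ZMod p) :
    ∑ ω : DitheredCode p m n, ∑ w' ∈ Finset.univ.erase w, ∑ v', ∏ t,
        periodicGauss (SNR / 8) √12 (ω.signal γ A (u w') v' t - ω.signal γ A (u w) v t)
      ≤ Fintype.card (DitheredCode p m n) * ENNReal.ofReal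
        (M * ((p : ℝ) ^ m * rateArgOne SNR p γ ^ n + p * rateArgTwo SNR p γ ^ n)) := by
  have h1 := (rateArgOne_pos SNR p γ).le
  have h2 := (rateArgTwo_pos SNR p γ).le
  rw [Finset.sum_comm]
  calc _ ≤ ∑ w' ∈ Finset.univ.erase w, (Fintype.card (DitheredCode p m n) : ℝ≥0∞)
          * ENNReal.ofReal ((p : ℝ) ^ m * rateArgOne SNR p γ ^ n + p * rateArgTwo SNR p γ ^ n) := by
        refine Finset.sum_le_sum fun w' hw' => ?_
        rw [Finset.sum_comm]
        calc _ ≤ ∑ v' : Fin m → ZMod p, (Fintype.card (DitheredCode p m n) : ℝ≥0∞) *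
              (ENNReal.ofReal (rateArgOne SNR p γ) ^ n
              + ∑ l : ZMod p, if v' = l • (u w' - u w) + v
                then ENNReal.ofReal (rateArgTwo SNR p γ) ^ n else 0) :=
              Finset.sum_le_sum fun v' _ => DitheredCode.sum_prod_le hS hδ A _ _ _ _
                fun h => (Finset.mem_erase.1 hw').1 (u.injective h)
          _ = _ := by
              rw [← Finset.mul_sum, Finset.sum_add_distrib, Finset.sum_comm]
              simp only [Finset.sum_ite_eq', Finset.mem_univ, if_true, Finset.sum_const,
                Finset.card_univ, ZMod.card, Fintype.card_fun, Fintype.card_fin, nsmul_eq_mul]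
              rw [ENNReal.ofReal_add (by positivity) (by positivity),
                ENNReal.ofReal_mul (by positivity), ENNReal.ofReal_mul (by positivity),
                ENNReal.ofReal_pow (by positivity), ENNReal.ofReal_pow h1, ENNReal.ofReal_pow h2,
                ENNReal.ofReal_natCast]
              simp only [Nat.cast_pow]
    _ ≤ (M : ℝ≥0∞) * ((Fintype.card (DitheredCode p m n) : ℝ≥0∞) * ENNReal.ofReal
          ((p : ℝ) ^ m * rateArgOne SNR p γ ^ n + p * rateArgTwo SNR p γ ^ n)) := by
        rw [Finset.sum_const, nsmul_eq_mul]
        gcongr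
        exact_mod_cast (Finset.card_le_univ _).trans (by simp)
    _ = _ := by
        rw [ENNReal.ofReal_mul (p := (M : ℝ)) (by positivity), ENNReal.ofReal_natCast]
        ring

end Code

/-! ### Existence of a good code at finite blocklength -/

instance isProbabilityMeasure_noiseLaw (K n : ℕ) (SNR : ℝ) :
    IsProbabilityMeasure (noiseLaw K n SNR) := by
  unfold noiseLaw; infer_instance

lemma noiseLaw_exists_le {K n M : ℕ} (h : Fin K → Fin K → ℝ) (SNR : ℝ)
    (x : Fin K → Fin n → ℝ) (g : Fin K → (Fin n → ℝ) → Fin M) (hg : ∀ j, Measurable (g j))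
    (w : Fin K → Fin M) :
    noiseLaw K n SNR {z | ∃ j, g j (received h x z j) ≠ w j}
      ≤ ∑ j, (Measure.pi fun _ : Fin n => gaussianReal 0 (1 / SNR).toNNReal)
        {z | g j (fun t => (∑ k, h j k * x k t) + z t) ≠ w j} := by
  have hU : {z | ∃ j, g j (received h x z j) ≠ w j}
      = ⋃ j, {z : Fin K → Fin n → ℝ | g j (received h x z j) ≠ w j} := by
    ext z; simp
  rw [hU]
  refine (measure_iUnion_fintype_le _ _).trans (Finset.sum_le_sum fun j _ => le_of_eq ?_)
  have hmeas : MeasurableSet {z : Fin n → ℝ | g j (fun t => (∑ k, h j k * x k t) + z t) ≠ w j} := by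
    have : Measurable fun z : Fin n → ℝ => g j (fun t => (∑ k, h j k * x k t) + z t) :=
      (hg j).comp (by fun_prop)
    exact (this (measurableSet_singleton (w j))).compl
  exact (measurePreserving_eval (fun _ : Fin K =>
    Measure.pi fun _ : Fin n => gaussianReal 0 (1 / SNR).toNNReal) j).measure_preimage
    hmeas.nullMeasurableSet

/-- Choosing a sample point where a cost of small mean and a constraint hold simultaneously. -/
lemma exists_le_one_and_le {Ω : Type*} [Fintype Ω] [Nonempty Ω] {P E : Ω → ℝ} {θ ε : ℝ}
    (hθ : 0 < θ) (hε : 0 < ε) (hP : ∀ ω, 0 ≤ P ω) (hE : ∀ ω, 0 ≤ E ω)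
    (hPs : ∑ ω, P ω ≤ Fintype.card Ω * (1 - θ)) (hEs : ∑ ω, E ω ≤ Fintype.card Ω * ε) :
    ∃ ω, P ω ≤ 1 ∧ E ω ≤ ε / θ := by
  -- The weight `θ / ε` makes the mean of the combined cost at most `(1 - θ) + θ = 1`.
  have hsum : ∑ ω, (P ω + θ / ε * E ω) ≤ ∑ _ω : Ω, (1 : ℝ) := by
    rw [Finset.sum_add_distrib, ← Finset.mul_sum]
    simp only [Finset.sum_const, Finset.card_univ, nsmul_eq_mul, mul_one]
    have h1 : θ / ε * ∑ ω, E ω ≤ θ / ε * (Fintype.card Ω * ε) := by gcongr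
    have h2 : θ / ε * (Fintype.card Ω * ε) = Fintype.card Ω * θ := by field_simp
    linarith
  obtain ⟨ω, -, hω⟩ := Finset.exists_le_of_sum_le Finset.univ_nonempty hsum
  have h3 : 0 ≤ θ / ε * E ω := mul_nonneg (by positivity) (hE ω)
  refine ⟨ω, by linarith, ?_⟩
  rw [le_div_iff₀ hθ]
  have h4 : θ / ε * E ω ≤ 1 := by linarith [hP ω]
  rw [div_mul_eq_mul_div, div_le_one hε] at h4
  linarith

/-- A finite blocklength bound for a common dithered linear code over `ZMod p`. -/
lemma exists_interferenceCode {K : ℕ} (hK : 0 < K) (h : Fin K → Fin K → ℝ) {SNR : ℝ}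
    (hS : 0 < SNR) (hint : ∀ j k, j ≠ k → ∃ a : ℤ, h j k = (a : ℝ)) {p : ℕ} [Fact p.Prime]
    (hδ : ∀ j, 0 < diophDelta p (h j j)) {M m : ℕ} (hM : 0 < M) (hMp : M ≤ p ^ m) (n : ℕ) :
    ∃ C : InterferenceCode K n (fun _ => M), C.errorProb h SNR ≤ (p : ℝ) ^ 2 *
      ∑ j, M * ((p : ℝ) ^ m * rateArgOne SNR p (h j j) ^ n + p * rateArgTwo SNR p (h j j) ^ n) := by
  have hp : (0 : ℝ) < p := by exact_mod_cast NeZero.pos p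
  have hM' : (0 : ℝ) < M := by exact_mod_cast hM
  have : Nonempty (Fin K) := ⟨⟨0, hK⟩⟩
  set ε : ℝ := ∑ j, M * ((p : ℝ) ^ m * rateArgOne SNR p (h j j) ^ n
    + p * rateArgTwo SNR p (h j j) ^ n) with hε
  have hterm : ∀ j, 0 < M * ((p : ℝ) ^ m * rateArgOne SNR p (h j j) ^ n
      + p * rateArgTwo SNR p (h j j) ^ n) := by
    intro j
    have h1 := rateArgOne_pos SNR p (h j j)
    have h2 := rateArgTwo_pos SNR p (h j j)
    positivity
  have hε0 : 0 < ε := Finset.sum_pos (fun j _ => hterm j) Finset.univ_nonempty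
  obtain ⟨u⟩ : Nonempty (Fin M ↪ (Fin m → ZMod p)) := by
    refine Function.Embedding.nonempty_of_card_le ?_
    simpa using hMp
  have hgain : ∀ j, ∃ a : Fin K → ℤ, a j = 0 ∧ ∀ k, j ≠ k → h j k = a k := by
    intro j
    choose a ha using fun k (hk : j ≠ k) => hint j k hk
    refine ⟨fun k => if hk : j ≠ k then a k hk else 0, by simp, fun k hk => ?_⟩
    simp only [dif_pos hk]
    exact ha k hk
  -- Setting `a j j = 0` lets the interference sum run over all users without counting the direct
  -- link.
  choose a ha0 ha using hgain
  let Ω := DitheredCode p m n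
  choose g hg hgerr using fun (ω : Ω) (j : Fin K) => exists_decoder hM hS √12
    (fun (w : Fin M) v => ω.signal (h j j) (∑ k, a j k) (u w) v)
  let err : Ω → (Fin K → Fin M) → ℝ≥0∞ := fun ω w =>
    noiseLaw K n SNR {z | ∃ j, g ω j (received h (fun k => ω.enc (u (w k))) z j) ≠ w j}
  have herr : ∀ w, ∑ ω, err ω w ≤ Fintype.card Ω * ENNReal.ofReal ε := by
    intro w
    have hbound : ∀ ω, err ω w ≤ ∑ j, ∑ w' ∈ Finset.univ.erase (w j), ∑ v', ∏ t,
        periodicGauss (SNR / 8) √12 (ω.signal (h j j) (∑ k, a j k) (u w') v' t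
          - ω.signal (h j j) (∑ k, a j k) (u (w j)) (∑ k, a j k • u (w k)) t) := by
      intro ω
      refine (noiseLaw_exists_le h SNR _ (g ω) (hg ω) w).trans (Finset.sum_le_sum fun j _ => ?_)
      refine hgerr ω j (w j) (∑ k, a j k • u (w k)) _ fun t => ?_
      obtain ⟨q, hq⟩ := ω.sum_gain_mul_enc (h j j) (a j) (u (w j)) (fun k => u (w k)) t
      refine ⟨q, ?_⟩
      rw [← hq, ← Finset.add_sum_erase _ _ (Finset.mem_univ j),
        ← Finset.add_sum_erase _ (fun k => (a j k : ℝ) * ω.enc (u (w k)) t) (Finset.mem_univ j),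
        ha0, Int.cast_zero, zero_mul, zero_add]
      congr 1
      refine Finset.sum_congr rfl fun k hk => ?_
      rw [ha j k (Finset.ne_of_mem_erase hk).symm]
    refine (Finset.sum_le_sum fun ω _ => hbound ω).trans ?_
    rw [Finset.sum_comm, hε, ENNReal.ofReal_sum_of_nonneg fun j _ => (hterm j).le, Finset.mul_sum]
    exact Finset.sum_le_sum fun j _ =>
      DitheredCode.sum_union_bound_le hS (hδ j) (∑ k, a j k) u (w j) _
  have herr' : ∀ w, ∑ ω, (err ω w).toReal ≤ Fintype.card Ω * ε := by
    intro w
    have h1 : ∀ ω ∈ Finset.univ, err ω w ≠ ∞ := fun ω _ => measure_ne_top _ _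
    rw [← ENNReal.toReal_sum h1]
    refine ENNReal.toReal_le_of_le_ofReal (by positivity) ((herr w).trans (le_of_eq ?_))
    rw [ENNReal.ofReal_mul (by positivity), ENNReal.ofReal_natCast]
  let pw : Ω → ℝ := fun ω =>
    (1 / (n : ℝ)) * ((1 / (M : ℝ)) * ∑ w : Fin M, ∑ t, (ω.enc (u w) t) ^ 2)
  let er : Ω → ℝ := fun ω =>
    (1 / (∏ _k : Fin K, (M : ℝ))) * ∑ w : Fin K → Fin M, (err ω w).toReal
  -- The slack in the mean power is `1 / p ^ 2`; dividing the mean error by it produces the factor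
  -- `p ^ 2` in the bound.
  have hθ : 0 < 1 / (p : ℝ) ^ 2 := by positivity
  have hθ1 : 1 / (p : ℝ) ^ 2 ≤ 1 := by
    rw [div_le_one (by positivity)]
    exact one_le_pow₀ (by exact_mod_cast NeZero.one_le)
  have hpw : ∑ ω, pw ω ≤ Fintype.card Ω * (1 - 1 / (p : ℝ) ^ 2) := by
    simp only [pw, ← Finset.mul_sum]
    rw [Finset.sum_comm]
    have h1 : ∀ w : Fin M, ∑ ω : Ω, ∑ t, (ω.enc (u w) t) ^ 2
        = n * (Fintype.card Ω * (1 - 1 / (p : ℝ) ^ 2)) := by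
      intro w
      rw [Finset.sum_comm]
      simp only [Ω, DitheredCode.sum_enc_sq, Finset.sum_const, Finset.card_univ,
        Fintype.card_fin, nsmul_eq_mul]
    simp only [h1, Finset.sum_const, Finset.card_univ, Fintype.card_fin, nsmul_eq_mul]
    have h2 : 1 / (n : ℝ) * (1 / (M : ℝ) * ((M : ℝ) * (n * (Fintype.card Ω
        * (1 - 1 / (p : ℝ) ^ 2))))) = (n / n : ℝ) * (Fintype.card Ω * (1 - 1 / (p : ℝ) ^ 2)) := by
      field_simp
    rw [h2]
    -- The quotient `n / n` is `0` at blocklength `0`, so only an inequality is available.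
    exact mul_le_of_le_one_left (mul_nonneg (by positivity) (by linarith)) (div_self_le_one _)
  have her : ∑ ω, er ω ≤ Fintype.card Ω * ε := by
    simp only [er, ← Finset.mul_sum]
    rw [Finset.sum_comm]
    calc _ ≤ (1 / (∏ _k : Fin K, (M : ℝ))) * ∑ _w : Fin K → Fin M, (Fintype.card Ω * ε) := by
          gcongr with w
          exact herr' w
      _ = _ := by
          simp only [Finset.prod_const, Finset.sum_const, Finset.card_univ, Fintype.card_fun,
            Fintype.card_fin, nsmul_eq_mul, Nat.cast_pow]
          field_simp
  obtain ⟨ω, hω1, hω2⟩ := exists_le_one_and_le hθ hε0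
    (fun ω => by positivity) (fun ω => by positivity) hpw her
  refine ⟨⟨fun _ w => ω.enc (u w), g ω, hg ω, fun _ => hω1⟩, ?_⟩
  rw [one_div, div_inv_eq_mul, mul_comm] at hω2
  exact hω2

/-! ### Degenerate codes, message counts and exponents -/

lemma InterferenceCode.errorProb_eq_zero {K n : ℕ} {M : Fin K → ℕ} (C : InterferenceCode K n M)
    (h : Fin K → Fin K → ℝ) (SNR : ℝ) (hM : ∀ k, M k = 1) : C.errorProb h SNR = 0 := by
  have : ∀ k, Subsingleton (Fin (M k)) := fun k => by rw [hM k]; infer_instance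
  have hempty : ∀ w : (∀ k, Fin (M k)),
      {z | ∃ j, C.dec j (received h (fun k => C.enc k (w k)) z j) ≠ w j} = ∅ := by
    intro w
    ext z
    simp only [Set.mem_ofPred_eq, Set.mem_empty_iff_false, iff_false, not_exists, not_not]
    exact fun j => Subsingleton.elim _ _
  simp [InterferenceCode.errorProb, hempty]

/-- The code that sends nothing and always decodes to the first message. -/
def InterferenceCode.silent (K n : ℕ) (M : Fin K → ℕ) (hM : ∀ k, 0 < M k) :
    InterferenceCode K n M where
  enc _ _ _ := 0
  dec j _ := ⟨0, hM j⟩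
  measurable_dec _ := measurable_const
  power _ := by simp

lemma numMessages_pos (n : ℕ) (R : ℝ) : 0 < numMessages n R :=
  Nat.ceil_pos.2 (by positivity)

lemma numMessages_eq_one (n : ℕ) {R : ℝ} (hR : R ≤ 0) : numMessages n R = 1 := by
  refine le_antisymm (Nat.ceil_le.2 ?_) (numMessages_pos n R)
  rw [Nat.cast_one]
  exact Real.rpow_le_one_of_one_le_of_nonpos one_le_two
    (mul_nonpos_of_nonneg_of_nonpos (by positivity) hR)

lemma numMessages_le (n : ℕ) {R : ℝ} (hR : 0 ≤ R) :
    (numMessages n R : ℝ) ≤ 2 * ((2 : ℝ) ^ R) ^ n := by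
  have h1 : (1 : ℝ) ≤ ((2 : ℝ) ^ R) ^ n := one_le_pow₀ (Real.one_le_rpow one_le_two hR)
  have h2 : (2 : ℝ) ^ ((n : ℝ) * R) = ((2 : ℝ) ^ R) ^ n := by
    rw [mul_comm, Real.rpow_mul_natCast (by norm_num)]
  have h3 := (Nat.ceil_lt_add_one (a := (2 : ℝ) ^ ((n : ℝ) * R)) (by positivity)).le
  rw [numMessages]
  rw [h2] at h3 ⊢
  linarith

/-- Rounding the number of messages up to a power of `p` costs at most a factor `p`, which does not
affect the exponent. -/
lemma Nat.pow_clog_le_mul {b x : ℕ} (hb : 1 < b) (hx : 0 < x) : b ^ Nat.clog b x ≤ b * x := by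
  rcases Nat.lt_or_ge 1 x with h | h
  · have h1 := Nat.pow_pred_clog_lt_self hb h
    have h2 := Nat.clog_pos hb h
    calc b ^ Nat.clog b x = b * b ^ (Nat.clog b x).pred := by
          rw [← pow_succ', Nat.succ_pred_eq_of_pos h2]
      _ ≤ b * x := Nat.mul_le_mul_left _ h1.le
  · have : x = 1 := by omega
    subst this
    simp
    omega

lemma rateArgOne_mul_lt_one {SNR R γ : ℝ} {p : ℕ} (h : R < rateTermOne SNR p γ) :
    ((2 : ℝ) ^ R) ^ 2 * rateArgOne SNR p γ < 1 := by
  have hpos := rateArgOne_pos SNR p γ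
  have h1 : Real.logb 2 (rateArgOne SNR p γ) < -(2 * R) := by
    rw [rateTermOne, ← rateArgOne] at h
    linarith
  rw [Real.logb_lt_iff_lt_rpow one_lt_two hpos] at h1
  calc ((2 : ℝ) ^ R) ^ 2 * rateArgOne SNR p γ
      < ((2 : ℝ) ^ R) ^ 2 * (2 : ℝ) ^ (-(2 * R)) := by gcongr
    _ = 1 := by
      rw [← Real.rpow_mul_natCast (by norm_num), ← Real.rpow_add (by norm_num)]
      simp [mul_comm]

lemma rateArgTwo_mul_lt_one {SNR R γ : ℝ} {p : ℕ} (hδ : diophDelta p γ ≠ 0)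
    (h : (R : EReal) < rateTermTwo SNR p γ) : (2 : ℝ) ^ R * rateArgTwo SNR p γ < 1 := by
  have hpos := rateArgTwo_pos SNR p γ
  rw [rateTermTwo, if_neg hδ, ← rateArgTwo, EReal.coe_lt_coe_iff] at h
  have h1 : Real.logb 2 (rateArgTwo SNR p γ) < -R := by linarith
  rw [Real.logb_lt_iff_lt_rpow one_lt_two hpos] at h1
  calc (2 : ℝ) ^ R * rateArgTwo SNR p γ
      < (2 : ℝ) ^ R * (2 : ℝ) ^ (-R) := by gcongr
    _ = 1 := by
      rw [← Real.rpow_add (by norm_num)]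
      simp

lemma diophDelta_ne_zero_of_lt {SNR R γ : ℝ} {p : ℕ} (h : (R : EReal) < rateTermTwo SNR p γ) :
    diophDelta p γ ≠ 0 := by
  intro h0
  rw [rateTermTwo, if_pos h0] at h
  exact not_lt_bot h

/-- The error bound of a rate-`R` common code decays when `R` is below both rate terms. -/
lemma tendsto_error_bound {K : ℕ} {R : ℝ} (p : ℕ) (A B : Fin K → ℝ)
    (hA0 : ∀ j, 0 < A j) (hB0 : ∀ j, 0 < B j)
    (hA : ∀ j, ((2 : ℝ) ^ R) ^ 2 * A j < 1) (hB : ∀ j, (2 : ℝ) ^ R * B j < 1) :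
    Tendsto (fun n : ℕ => (p : ℝ) ^ 2 * ∑ j, (4 * p * (((2 : ℝ) ^ R) ^ 2 * A j) ^ n
      + 2 * p * ((2 : ℝ) ^ R * B j) ^ n)) atTop (𝓝 0) := by
  have h1 : ∀ j, Tendsto (fun n : ℕ => 4 * p * (((2 : ℝ) ^ R) ^ 2 * A j) ^ n
      + 2 * p * ((2 : ℝ) ^ R * B j) ^ n) atTop (𝓝 0) := by
    intro j
    have hAj := hA0 j
    have hBj := hB0 j
    have h2 := (tendsto_pow_atTop_nhds_zero_of_lt_one (by positivity) (hA j)).const_mul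
      (4 * (p : ℝ))
    have h3 := (tendsto_pow_atTop_nhds_zero_of_lt_one (by positivity) (hB j)).const_mul
      (2 * (p : ℝ))
    simpa using h2.add h3
  have h4 := (tendsto_finsetSum Finset.univ fun j _ => h1 j).const_mul ((p : ℝ) ^ 2)
  simpa using h4

end

/-! ### Conclusion: choice of the prime and of the code dimension -/

theorem theorem2 {K : ℕ} (h : Fin K → Fin K → ℝ) (SNR : ℝ) (hSNR : 0 < SNR)
    (hint : ∀ j k, j ≠ k → ∃ a : ℤ, h j k = (a : ℝ))
    (R : ℝ)
    (hR : (R : EReal) <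
      ⨆ p ∈ ⋂ j, admissiblePrimes SNR (h j j), ⨅ j, rateBound SNR p (h j j)) :
    SymmetricRateAchievable h SNR R := by
  -- For `R ≤ 0` each user has one message, and for `K = 0` there is no receiver that could err.
  by_cases htriv : R ≤ 0 ∨ K = 0
  · refine ⟨fun n => InterferenceCode.silent K n _ fun _ => numMessages_pos n R, ?_⟩
    refine tendsto_const_nhds.congr fun n => (InterferenceCode.errorProb_eq_zero _ h SNR ?_).symm
    rcases htriv with hR0 | rfl
    · exact fun _ => numMessages_eq_one n hR0
    · exact fun k => k.elim0
  push Not at htriv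
  obtain ⟨hR0, hK0⟩ := htriv
  have hK : 0 < K := Nat.pos_of_ne_zero hK0
  obtain ⟨p, hp⟩ := lt_iSup_iff.1 hR
  obtain ⟨hmem, hp⟩ := lt_iSup_iff.1 hp
  have hprime : p.Prime := (Set.mem_iInter.1 hmem ⟨0, hK⟩).1
  have : Fact p.Prime := ⟨hprime⟩
  have hbound : ∀ j, R < rateTermOne SNR p (h j j) ∧
      (R : EReal) < rateTermTwo SNR p (h j j) := fun j => by
    have := lt_of_lt_of_le hp (iInf_le _ j)
    rw [rateBound, lt_min_iff, EReal.coe_lt_coe_iff] at this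
    exact this
  have hδ0 : ∀ j, diophDelta p (h j j) ≠ 0 := fun j => diophDelta_ne_zero_of_lt (hbound j).2
  have hδ : ∀ j, 0 < diophDelta p (h j j) := fun j =>
    lt_of_le_of_ne (diophDelta_nonneg _ _) (hδ0 j).symm
  -- The dimension is the least `m` for which `p ^ m` is at least the number of messages.
  choose C hC using fun n => exists_interferenceCode hK h hSNR hint hδ (numMessages_pos n R)
    (Nat.le_pow_clog hprime.one_lt (numMessages n R)) n
  refine ⟨C, squeeze_zero (fun n => ?_) (fun n => (hC n).trans ?_)
    (tendsto_error_bound p (fun j => rateArgOne SNR p (h j j)) (fun j => rateArgTwo SNR p (h j j))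
      (fun j => rateArgOne_pos _ _ _) (fun j => rateArgTwo_pos _ _ _)
      (fun j => rateArgOne_mul_lt_one (hbound j).1)
      (fun j => rateArgTwo_mul_lt_one (hδ0 j) (hbound j).2))⟩
  · unfold InterferenceCode.errorProb
    positivity
  · have h1 := numMessages_le n hR0.le
    have h2 : ((p : ℝ) ^ Nat.clog p (numMessages n R)) ≤ p * numMessages n R := by
      exact_mod_cast Nat.pow_clog_le_mul hprime.one_lt (numMessages_pos n R)
    gcongr with j
    have hA := rateArgOne_pos SNR p (h j j)
    have hB := rateArgTwo_pos SNR p (h j j)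
    set N : ℝ := (numMessages n R : ℝ)
    set x : ℝ := (2 : ℝ) ^ R
    have hN : 0 ≤ N := Nat.cast_nonneg _
    calc N * ((p : ℝ) ^ Nat.clog p (numMessages n R) * rateArgOne SNR p (h j j) ^ n
          + p * rateArgTwo SNR p (h j j) ^ n)
        -- Both `N ≤ 2 * x ^ n` and `p ^ m ≤ p * N` enter the first summand, giving `4 * p` and the
        -- square of `x`; the second needs only the former, giving `2 * p`.
        ≤ (2 * x ^ n) * ((p * (2 * x ^ n)) * rateArgOne SNR p (h j j) ^ n
          + p * rateArgTwo SNR p (h j j) ^ n) := by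
          gcongr
          exact h2.trans (by gcongr)
      _ = _ := by
          rw [mul_pow, mul_pow, ← pow_mul, mul_comm 2 n, pow_mul]
          ring
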